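/- A topological space $X$ is called a $k_R$-space if $X$ is Tychonoff and a function $f : X \to \mathbb{R}$ is continuous if and only if its restriction to every compact subset of $X$ is continuous. For a Tychonoff space $X$, let $A(X)$ be the free Abelian topological group over $X$, that is, the free Abelian group on the set $X$ equipped with the finest group topology for which the canonical map $X \to A(X)$ is continuous. Every $g \in A(X)$ can be written uniquely as $g = r_1x_1 + \dots + r_mx_m$ with $m \ge 0$, $r_i \in \mathbb{Z}\setminus\{0\}$ and pairwise distinct $x_i \in X$; its reduced length is $\sum_{i=1}^{m} |r_i|$. Let $A_n(X)$ be the subspace of $A(X)$ consisting of all elements of reduced length at most $n$. Let $\mathbf{G}_1 = \bigoplus_{\alpha<\omega_1} C_\alpha$ be the topological sum of $\omega_1$ convergent sequences, where $C_\alpha = \{c(\alpha,n) : n \in \mathbb{N}\} \cup \{c_\alpha\}$ is a nontrivial sequence $c(\alpha,n) \to c_\alpha$ (as $n\to\infty$) together with its limit. **Proposition.** The subspace $A_4(\mathbf{G}_1)$ of $A(\mathbf{G}_1)$ is not a $k_R$-space. -/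

import Mathlib

open Topology
open scoped Ordinal

section KR

/-- A `k_R`-space: a Tychonoff space on which a real-valued function is continuous if and only if
its restriction to every compact subset is continuous. -/
def IsKRSpace (X : Type*) [TopologicalSpace X] : Prop :=
  T35Space X ∧ ∀ f : X → ℝ, Continuous f ↔ ∀ K : Set X, IsCompact K → ContinuousOn f K

end KR

namespace FreeAbelianTop

universe u v

/-- The free Abelian topological group `A(X)`: the free abelian group on the set `X`, with the
finest group topology for which the canonical map `X → A(X)` is continuous. -/
instance instTopologicalSpace (X : Type u) [TopologicalSpace X] :
    TopologicalSpace (FreeAbelianGroup X) :=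
  (AddGroupTopology.coinduced (FreeAbelianGroup.of : X → FreeAbelianGroup X)).toTopologicalSpace

instance instIsTopologicalAddGroup (X : Type u) [TopologicalSpace X] :
    IsTopologicalAddGroup (FreeAbelianGroup X) :=
  (AddGroupTopology.coinduced
    (FreeAbelianGroup.of : X → FreeAbelianGroup X)).toIsTopologicalAddGroup

/-- The canonical map `X → A(X)` is continuous. -/
theorem continuous_of (X : Type u) [TopologicalSpace X] :
    Continuous (FreeAbelianGroup.of : X → FreeAbelianGroup X) :=
  AddGroupTopology.coinduced_continuous _

/-- The image of `X` generates `A(X)` algebraically. -/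
theorem closure_range_of (X : Type u) :
    AddSubgroup.closure (Set.range (FreeAbelianGroup.of : X → FreeAbelianGroup X)) = ⊤ := by
  rw [eq_top_iff]
  intro a _
  induction a using FreeAbelianGroup.induction_on with
  | zero => exact zero_mem _
  | of x => exact AddSubgroup.subset_closure ⟨x, rfl⟩
  | neg x hx => exact neg_mem (AddSubgroup.subset_closure ⟨x, rfl⟩)
  | add a b ha hb => exact add_mem (ha trivial) (hb trivial)

/-- The universal property: a continuous map from `X` to an Abelian topological group extends to a
continuous homomorphism on `A(X)`. -/
theorem continuous_lift {X : Type u} [TopologicalSpace X] {G : Type v} [AddCommGroup G]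
    [TopologicalSpace G] [IsTopologicalAddGroup G] {f : X → G} (hf : Continuous f) :
    Continuous (FreeAbelianGroup.lift f : FreeAbelianGroup X →+ G) := by
  let φ : FreeAbelianGroup X →+ G := FreeAbelianGroup.lift f
  let t : AddGroupTopology (FreeAbelianGroup X) :=
    { toTopologicalSpace := TopologicalSpace.induced φ inferInstance
      toIsTopologicalAddGroup := topologicalAddGroup_induced φ }
  have ht : AddGroupTopology.coinduced (FreeAbelianGroup.of : X → FreeAbelianGroup X) ≤ t := by
    refine sInf_le ?_
    change TopologicalSpace.coinduced _ _ ≤ TopologicalSpace.induced φ inferInstance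
    rw [← continuous_iff_coinduced_le, continuous_induced_rng]
    convert hf using 1
    funext x
    simp [φ]
  exact continuous_iff_le_induced.2 ht

/-- For a Tychonoff space `X`, the group `A(X)` is again Tychonoff. -/
theorem t35Space (X : Type u) [TopologicalSpace X] [T35Space X] :
    T35Space (FreeAbelianGroup X) := by
  have hcr : CompletelyRegularSpace (FreeAbelianGroup X) :=
    CompletelyRegularSpace.of_exists_uniformSpace
      ⟨IsTopologicalAddGroup.rightUniformSpace (FreeAbelianGroup X), rfl⟩
  have ht2 : T2Space (FreeAbelianGroup X) := by
    refine ⟨fun g h hgh => ?_⟩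
    have hd : (g - h).support.Nonempty :=
      FreeAbelianGroup.nonempty_support_iff.2 (sub_ne_zero.2 hgh)
    obtain ⟨x, hx⟩ := hd
    obtain ⟨f, hf, hfx, hf1⟩ := CompletelyRegularSpace.completely_regular x
      (((g - h).support : Set X) \ {x})
      ((g - h).support.finite_toSet.subset Set.sdiff_subset).isClosed (by simp)
    let F : X → ℝ := fun y => 1 - (f y : ℝ)
    have hF : Continuous F := by fun_prop
    refine separated_by_continuous (continuous_lift hF) fun heq => ?_
    have h0 : FreeAbelianGroup.lift F (g - h) = 0 := by rw [map_sub, heq, sub_self]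
    rw [FreeAbelianGroup.eq_sum_support_coeff_smul_of (g - h), map_sum,
      Finset.sum_eq_single x] at h0
    · have hc := (FreeAbelianGroup.mem_support_iff x (g - h)).1 hx
      simp only [map_zsmul, FreeAbelianGroup.lift_apply_of, F, hfx] at h0
      simp at h0
      apply hc
      rw [map_sub]
      exact_mod_cast h0
    · intro y hy hyx
      have : f y = 1 := hf1 ⟨hy, hyx⟩
      simp [F, this]
    · intro h; exact absurd hx h
  exact { }

/-- The reduced length `∑ |rᵢ|` of `g = r₁x₁ + ⋯ + rₙxₙ` with distinct `xᵢ ∈ X`. -/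
noncomputable def reducedLength {X : Type u} (g : FreeAbelianGroup X) : ℕ :=
  ∑ x ∈ g.support, (FreeAbelianGroup.coeff x g).natAbs

/-- `Aₙ(X)`: the elements of `A(X)` of reduced length at most `n`, regarded as a subspace. -/
def words (X : Type u) (n : ℕ) : Set (FreeAbelianGroup X) :=
  {g | reducedLength g ≤ n}

end FreeAbelianTop

/-- The topological sum of `ω₁` copies of a nontrivial convergent sequence together with its
limit. -/
abbrev G₁ : Type 1 := Σ _ : Set.Iio (ω₁ : Ordinal.{0}), OnePoint ℕ

open Filter OnePoint FreeAbelianGroup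

namespace FreeAbelianTop

universe u

/-! ### Coefficients and reduced length -/

section Length

variable {X : Type u}

/-! For each `α < ω₁` fix an injection `e α` of the predecessors of `α` into `ℕ`, and let `H`
consist of the words `pairWord α β (e α β)` with `β < α`. These have the maximal length 4 and
isolated letters, so each is isolated in `A₄`. A compact set involves isolated letters from only
finitely many sequences (`finite_of_isCompact`), so it meets `H` in a finite set, and the indicator
of `H` is continuous on compacta. Yet `0 ∉ H` lies in the closure of `H`
(`zero_mem_closure_pairWords`), so the indicator is discontinuous. -/

theorem ext_coeff {g h : FreeAbelianGroup X} (H : ∀ x, coeff x g = coeff x h) : g = h :=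
  (equivFinsupp X).injective (Finsupp.ext H)

open Classical in
theorem coeff_of (x y : X) : coeff x (of y) = if y = x then 1 else 0 := by
  simp [coeff, Finsupp.single_apply]

theorem reducedLength_eq_sum {g : FreeAbelianGroup X} {S : Finset X} (hS : g.support ⊆ S) :
    reducedLength g = ∑ x ∈ S, (coeff x g).natAbs :=
  Finset.sum_subset hS fun x _ hx => by simpa using (notMem_support_iff x g).1 hx

/-- A word of reduced length `n` is determined, among the words of reduced length at most `n`, by
its coefficients on its own support. -/
theorem eq_of_coeff_eq_on_support {g h : FreeAbelianGroup X}
    (hle : reducedLength g ≤ reducedLength h) (H : ∀ x ∈ h.support, coeff x g = coeff x h) :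
    g = h := by
  have hsub : h.support ⊆ g.support := fun x hx => by
    rw [mem_support_iff, H x hx]
    exact (mem_support_iff x h).1 hx
  refine ext_coeff fun x => ?_
  by_cases hx : x ∈ h.support
  · exact H x hx
  rw [(notMem_support_iff x h).1 hx]
  by_contra hgx
  -- A letter of `g` outside the support of `h` would make `g` strictly longer than `h`.
  have hlt : ∑ y ∈ h.support, (coeff y g).natAbs < ∑ y ∈ g.support, (coeff y g).natAbs :=
    Finset.sum_lt_sum_of_subset hsub ((mem_support_iff x g).2 hgx) hx
      (Int.natAbs_pos.2 hgx) fun _ _ _ => Nat.zero_le _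
  rw [Finset.sum_congr rfl fun y hy => by rw [H y hy]] at hlt
  exact absurd hle (not_le.2 hlt)

theorem reducedLength_of_sub_of_add {a b c d : X} (hab : a ≠ b) (hac : a ≠ c) (had : a ≠ d)
    (hbc : b ≠ c) (hbd : b ≠ d) (hcd : c ≠ d) :
    reducedLength ((of a - of b) + (of c - of d)) = 4 := by
  classical
  have hS : ((of a - of b) + (of c - of d)).support ⊆ {a, b, c, d} := by
    intro x hx
    rw [mem_support_iff] at hx
    contrapose! hx
    simp only [Finset.mem_insert, Finset.mem_singleton, not_or] at hx
    obtain ⟨h1, h2, h3, h4⟩ := hx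
    simp [coeff_of, Ne.symm h1, Ne.symm h2, Ne.symm h3, Ne.symm h4]
  rw [reducedLength_eq_sum hS]
  simp [coeff_of, Finset.sum_insert, *, Ne.symm hab, Ne.symm hac, Ne.symm had, Ne.symm hbc,
    Ne.symm hbd, Ne.symm hcd]

end Length

theorem continuous_coeff {X : Type u} [TopologicalSpace X] {x : X} (hx : IsClopen {x}) :
    Continuous (coeff x) := by
  classical
  have hc : Continuous fun y => coeff x (of y) := by
    simp only [coeff_of]
    exact continuous_const.if (fun y hy => absurd (hx.frontier_eq ▸ hy : y ∈ (∅ : Set X))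
      (Set.notMem_empty y)) continuous_const
  convert continuous_lift hc using 2
  exact lift_ext _ _ fun y => by simp

/-- A word of reduced length `n` all of whose letters are isolated points of `X` is an isolated
point of `Aₙ(X)`. -/
theorem isClopen_singleton {X : Type u} [TopologicalSpace X] (h : FreeAbelianGroup X)
    (hX : ∀ x ∈ h.support, IsClopen {x}) :
    IsClopen {g : words X (reducedLength h) | (g : FreeAbelianGroup X) = h} := by
  have key : {g : words X (reducedLength h) | (g : FreeAbelianGroup X) = h} =
      ⋂ x ∈ h.support,
        (fun g : words X (reducedLength h) => coeff x (g : FreeAbelianGroup X)) ⁻¹'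
          {coeff x h} := by
    ext g
    simp only [Set.mem_ofPred_eq, Set.mem_iInter, Set.mem_preimage, Set.mem_singleton_iff]
    exact ⟨fun hg x _ => by rw [hg], fun H => eq_of_coeff_eq_on_support g.2 H⟩
  rw [key]
  exact h.support.finite_toSet.isClopen_biInter fun x hx =>
    (isClopen_discrete _).preimage ((continuous_coeff (hX x hx)).comp continuous_subtype_val)

/-! ### Sums of convergent sequences -/

section Sequences

variable {D : Type u}

/-- The `n`-th isolated point of the `α`-th convergent sequence. -/
def seqPoint (α : D) (n : ℕ) : Σ _ : D, OnePoint ℕ := ⟨α, (n : OnePoint ℕ)⟩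

theorem seqPoint_inj {α β : D} {m n : ℕ} : seqPoint α m = seqPoint β n ↔ α = β ∧ m = n := by
  simp [seqPoint, Sigma.mk.injEq]

theorem isClopen_singleton_seqPoint (α : D) (n : ℕ) : IsClopen {seqPoint α n} := by
  refine ⟨isClosed_singleton, ?_⟩
  have h : IsOpen ((fun k : ℕ => (k : OnePoint ℕ)) '' {n}) :=
    isOpenEmbedding_coe.isOpenMap _ (isOpen_discrete _)
  have := isOpenMap_sigmaMk (σ := fun _ : D => OnePoint ℕ) (i := α) _ h
  simpa [seqPoint] using this

theorem tendsto_seqPoint (α : D) :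
    Tendsto (seqPoint α) atTop (𝓝 ⟨α, ∞⟩) :=
  (continuous_sigmaMk (σ := fun _ : D => OnePoint ℕ) (i := α)).continuousAt.tendsto.comp
    ((continuous_iff_from_nat id).1 continuous_id)

/-- The letters of the words in a compact subset of `A(X)` which are isolated points of `X` lie in
finitely many of the convergent sequences. -/
theorem finite_of_isCompact {K : Set (FreeAbelianGroup (Σ _ : D, OnePoint ℕ))}
    (hK : IsCompact K) : {α : D | ∃ g ∈ K, ∃ n, coeff (seqPoint α n) g ≠ 0}.Finite := by
  classical
  set B := {α : D | ∃ g ∈ K, ∃ n, coeff (seqPoint α n) g ≠ 0}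
  have hB : ∀ α : D, ∃ n, α ∈ B → ∃ g ∈ K, coeff (seqPoint α n) g ≠ 0 := fun α => by
    by_cases h : α ∈ B
    · obtain ⟨g, hg, n, hn⟩ := id h
      exact ⟨n, fun _ => ⟨g, hg, hn⟩⟩
    · exact ⟨0, fun h' => absurd h' h⟩
  choose s hs using hB
  let : TopologicalSpace (D →₀ ℤ) := ⊥
  have : DiscreteTopology (D →₀ ℤ) := ⟨rfl⟩
  -- `f` keeps one isolated point per sequence, so it is continuous into a discrete group. Its
  -- extension to `A(X)` records the coefficients at the points `s α` and has finite image on `K`.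
  let f : (Σ _ : D, OnePoint ℕ) → (D →₀ ℤ) := fun x =>
    if x = seqPoint x.1 (s x.1) then Finsupp.single x.1 1 else 0
  have hf : Continuous f := by
    refine continuous_sigma fun α => (continuous_iff_from_nat _).2 ?_
    refine tendsto_const_nhds.congr' ?_
    filter_upwards [eventually_gt_atTop (s α)] with n hn
    have h1 : (⟨α, ∞⟩ : Σ _ : D, OnePoint ℕ) ≠ seqPoint α (s α) := by simp [seqPoint]
    have h2 : (⟨α, (n : OnePoint ℕ)⟩ : Σ _ : D, OnePoint ℕ) ≠ seqPoint α (s α) := by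
      simp [seqPoint, hn.ne']
    simp [f, h1, h2]
  have hval : ∀ (α : D) g, lift f g α = coeff (seqPoint α (s α)) g := fun α g => by
    have : (Finsupp.applyAddHom α).comp (lift f) = coeff (seqPoint α (s α)) := by
      refine lift_ext _ _ fun x => ?_
      rcases eq_or_ne x.1 α with rfl | hx
      · by_cases hx : x = seqPoint x.1 (s x.1)
        · simp [f, coeff_of, ← hx]
        · simp [f, coeff_of, hx]
      · have hne : x ≠ seqPoint α (s α) := fun h => hx (by rw [h]; rfl)
        by_cases hx' : x = seqPoint x.1 (s x.1)
        · simp only [f, AddMonoidHom.comp_apply, lift_apply_of, if_pos hx']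
          simp [coeff_of, hne, hx]
        · simp only [f, AddMonoidHom.comp_apply, lift_apply_of, if_neg hx']
          simp [coeff_of, hne]
    exact DFunLike.congr_fun this g
  have hfin : (lift f '' K).Finite := (hK.image (continuous_lift hf)).finite_of_discrete
  refine (hfin.biUnion fun p _ => p.support.finite_toSet).subset fun α hα => ?_
  obtain ⟨g, hg, hn⟩ := hs α hα
  refine Set.mem_biUnion (Set.mem_image_of_mem _ hg) ?_
  rw [Finset.mem_coe, Finsupp.mem_support_iff, hval]
  exact hn

/-- The word `(c(α, n) - c(α, n + 1)) + (c(β, n) - c(β, n + 1))`. -/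
def pairWord (α β : D) (n : ℕ) : FreeAbelianGroup (Σ _ : D, OnePoint ℕ) :=
  (of (seqPoint α n) - of (seqPoint α (n + 1))) + (of (seqPoint β n) - of (seqPoint β (n + 1)))

theorem reducedLength_pairWord {α β : D} (h : α ≠ β) (n : ℕ) :
    reducedLength (pairWord α β n) = 4 := by
  apply reducedLength_of_sub_of_add <;> simp [seqPoint_inj, h]

theorem coeff_pairWord_left {α β : D} (h : α ≠ β) (n : ℕ) :
    coeff (seqPoint α n) (pairWord α β n) = 1 := by
  simp [pairWord, coeff_of, seqPoint_inj, h.symm]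

theorem coeff_pairWord_right {α β : D} (h : α ≠ β) (n : ℕ) :
    coeff (seqPoint β n) (pairWord α β n) = 1 := by
  simp [pairWord, coeff_of, seqPoint_inj, h]

theorem isClopen_singleton_pairWord {α β : D} (h : α ≠ β) (n : ℕ) :
    IsClopen {g : words (Σ _ : D, OnePoint ℕ) 4 |
      (g : FreeAbelianGroup (Σ _ : D, OnePoint ℕ)) = pairWord α β n} := by
  classical
  rw [← reducedLength_pairWord h n]
  refine isClopen_singleton _ fun x hx => ?_
  have hx' : ∃ γ m, x = seqPoint γ m := by
    rw [mem_support_iff] at hx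
    contrapose! hx
    simp [pairWord, coeff_of, fun γ m => (hx γ m).symm]
  obtain ⟨γ, m, rfl⟩ := hx'
  exact isClopen_singleton_seqPoint γ m

/-- The words `pairWord α β (e α β)` with `β < α`. -/
def pairWords [LT D] (e : D → D → ℕ) : Set (FreeAbelianGroup (Σ _ : D, OnePoint ℕ)) :=
  {g | ∃ α β, β < α ∧ g = pairWord α β (e α β)}

/-- Each such word is determined by `(α, β)`, and both indices lie in the finite set attached to
`K`. -/
theorem finite_pairWords_inter [Preorder D] (e : D → D → ℕ)
    {K : Set (FreeAbelianGroup (Σ _ : D, OnePoint ℕ))} (hK : IsCompact K) :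
    (pairWords e ∩ K).Finite := by
  have hB := finite_of_isCompact hK
  refine ((hB.prod hB).image fun p => pairWord p.1 p.2 (e p.1 p.2)).subset ?_
  rintro _ ⟨⟨α, β, hβα, rfl⟩, hg⟩
  refine ⟨(α, β), ⟨⟨_, hg, e α β, ?_⟩, ⟨_, hg, e α β, ?_⟩⟩, rfl⟩
  · rw [coeff_pairWord_left hβα.ne']; exact one_ne_zero
  · rw [coeff_pairWord_right hβα.ne']; exact one_ne_zero

/-- An uncountable subset of a linear order with countable initial segments contains a point with
infinitely many points of the subset below it. -/
theorem exists_infinite_inter_Iio [LinearOrder D] (hD : ∀ α : D, (Set.Iio α).Countable)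
    {S : Set D} (hS : ¬ S.Countable) : ∃ α ∈ S, (S ∩ Set.Iio α).Infinite := by
  have hinf : S.Infinite := fun h => hS h.countable
  obtain ⟨T, hTS, hT, hTc⟩ : ∃ T ⊆ S, T.Infinite ∧ T.Countable :=
    ⟨Set.range fun n => (hinf.natEmbedding S n : D), by rintro _ ⟨n, rfl⟩; exact Subtype.property _,
      Set.infinite_range_of_injective
        (Subtype.val_injective.comp (hinf.natEmbedding S).injective), Set.countable_range _⟩
  have hU : (⋃ t ∈ T, Set.Iic t).Countable := hTc.biUnion fun t _ => by
    rw [← Set.Iio_insert]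
    exact (hD t).insert t
  -- The points not above all of `T` form a countable set, which cannot cover `S`.
  obtain ⟨α, hαS, hα⟩ : ∃ α ∈ S, α ∉ ⋃ t ∈ T, Set.Iic t := by
    by_contra! h
    exact hS (hU.mono h)
  simp only [Set.mem_iUnion, Set.mem_Iic, not_exists, not_le] at hα
  exact ⟨α, hαS, hT.mono fun t ht => ⟨hTS ht, hα t ht⟩⟩

theorem zero_mem_closure_pairWords [LinearOrder D] (hD : ∀ α : D, (Set.Iio α).Countable)
    [Uncountable D] {e : D → D → ℕ} (he : ∀ α, Set.InjOn (e α) (Set.Iio α)) :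
    (0 : FreeAbelianGroup (Σ _ : D, OnePoint ℕ)) ∈ closure (pairWords e) := by
  rw [mem_closure_iff_nhds]
  intro U hU
  obtain ⟨V, hV, hVU⟩ := exists_nhds_zero_half hU
  have hev : ∀ α : D, ∃ k, ∀ n ≥ k, of (seqPoint α n) - of (seqPoint α (n + 1)) ∈ V := by
    intro α
    have h1 := ((continuous_of (Σ _ : D, OnePoint ℕ)).tendsto _).comp (tendsto_seqPoint α)
    have h2 := h1.sub (h1.comp (tendsto_add_atTop_nat 1))
    rw [sub_self] at h2
    exact eventually_atTop.1 (h2.eventually hV)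
  choose f hf using hev
  -- Pigeonhole: a single threshold `k` serves uncountably many sequences.
  obtain ⟨k, hk⟩ : ∃ k, ¬ (f ⁻¹' {k}).Countable := by
    by_contra! h
    refine Set.not_countable_univ (α := D) ((Set.countable_iUnion h).mono fun α _ => ?_)
    exact Set.mem_iUnion.2 ⟨f α, rfl⟩
  obtain ⟨α, hα, hinf⟩ := exists_infinite_inter_Iio hD hk
  -- `e α` is injective on infinitely many `β` with threshold `k`, so some `e α β` exceeds `k`; both
  -- differences in the word then lie in `V`.
  obtain ⟨_, ⟨β, ⟨hβ, hβα⟩, rfl⟩, hlt⟩ :=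
    (hinf.image ((he α).mono Set.inter_subset_right)).exists_gt k
  exact ⟨pairWord α β (e α β), hVU _ (hf α _ (hα.trans_le hlt.le)) _ (hf β _ (hβ.trans_le hlt.le)),
    α, β, hβα, rfl⟩

theorem not_isKRSpace_words_four [LinearOrder D] (hD : ∀ α : D, (Set.Iio α).Countable)
    [Uncountable D] : ¬ IsKRSpace (words (Σ _ : D, OnePoint ℕ) 4) := by
  rintro ⟨-, hKR⟩
  choose e he using fun α => Set.countable_iff_exists_injOn.1 (hD α)
  let H : Set (words (Σ _ : D, OnePoint ℕ) 4) := Subtype.val ⁻¹' pairWords e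
  have hcont : Continuous (H.indicator fun _ => (1 : ℝ)) := by
    refine (hKR _).2 fun K hK => ?_
    have hfin : (H ∩ K).Finite := by
      refine Set.Finite.of_finite_image (f := Subtype.val) ?_ Subtype.val_injective.injOn
      refine (finite_pairWords_inter e (hK.image continuous_subtype_val)).subset ?_
      rintro _ ⟨g, ⟨hgH, hgK⟩, rfl⟩
      exact ⟨hgH, Set.mem_image_of_mem _ hgK⟩
    have hclopen : IsClopen (H ∩ K) := by
      rw [← Set.biUnion_of_singleton (H ∩ K)]
      refine hfin.isClopen_biUnion fun g hg => ?_
      obtain ⟨α, β, hβα, hg'⟩ := hg.1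
      convert isClopen_singleton_pairWord hβα.ne' (e α β) using 1
      ext x
      rw [Set.mem_singleton_iff, Set.mem_ofPred_eq, ← hg', Subtype.ext_iff]
    have hind : Continuous ((H ∩ K).indicator fun _ => (1 : ℝ)) :=
      continuous_const.indicator fun g hg =>
        absurd (hclopen.frontier_eq ▸ hg) (Set.notMem_empty g)
    -- On `K` the indicators of `H` and `H ∩ K` agree.
    refine hind.continuousOn.congr fun g hg => ?_
    by_cases h : g ∈ H <;> simp [h, hg]
  have h0 : (0 : FreeAbelianGroup (Σ _ : D, OnePoint ℕ)) ∈ words (Σ _ : D, OnePoint ℕ) 4 := by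
    simp [words, reducedLength]
  have hcl : (⟨0, h0⟩ : words (Σ _ : D, OnePoint ℕ) 4) ∈ closure H := by
    rw [closure_subtype]
    convert zero_mem_closure_pairWords hD he
    rw [Subtype.image_preimage_coe, Set.inter_eq_right]
    rintro _ ⟨α, β, hβα, rfl⟩
    exact (reducedLength_pairWord hβα.ne' _).le
  have hone : H.indicator (fun _ => (1 : ℝ)) ⟨0, h0⟩ = 1 :=
    closure_minimal (fun g hg => Set.indicator_of_mem hg _)
      (isClosed_singleton.preimage hcont) hcl
  have hmem : (⟨0, h0⟩ : words (Σ _ : D, OnePoint ℕ) 4) ∈ H := by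
    by_contra h
    rw [Set.indicator_of_notMem h] at hone
    exact zero_ne_one hone
  obtain ⟨α, β, hβα, h⟩ := hmem
  have h1 := coeff_pairWord_left hβα.ne' (e α β)
  rw [← h] at h1
  simp at h1

end Sequences

end FreeAbelianTop

/-! ### The index set `ω₁` -/

theorem countable_Iio_of_lt_omega_one (α : Set.Iio (ω₁ : Ordinal.{0})) :
    (Set.Iio α).Countable := by
  have h : (Set.Iio (α : Ordinal.{0})).Countable := by
    rw [← Cardinal.le_aleph0_iff_set_countable, Cardinal.mk_Iio_ordinal, Cardinal.lift_le_aleph0]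
    obtain ⟨a, ha⟩ := α
    rwa [Set.mem_Iio, ← Cardinal.ord_aleph, Cardinal.lt_ord, ← Cardinal.succ_aleph0,
      Order.lt_succ_iff] at ha
  exact (h.preimage Subtype.val_injective).mono fun β hβ => hβ

theorem uncountable_Iio_omega_one : Uncountable (Set.Iio (ω₁ : Ordinal.{0})) := by
  rw [← Cardinal.aleph0_lt_mk_iff, Cardinal.mk_Iio_ordinal, Cardinal.aleph0_lt_lift,
    Ordinal.card_omega]
  exact Cardinal.aleph0_lt_aleph_one

theorem mainTheorem10 : ¬ IsKRSpace (FreeAbelianTop.words G₁ 4) :=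
  have := uncountable_Iio_omega_one
  FreeAbelianTop.not_isKRSpace_words_four countable_Iio_of_lt_omega_one
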